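/- For a complex number $q$ with $|q|<1$ let $$F(q)=\sum_{m,n\ge 1}\frac{(-q)^{2mn+m-1}}{(1+q^{2n-1})(1-q^{2m-1})}.$$ The double series converges absolutely for every $q$ with $|q|<1$, and $F$ is given on the open unit disc by a convergent power series in $q$. Writing $[q^k]F(q)$ for the coefficient of $q^k$ in it, for every integer $r\ge 1$ we have $$[q^{2r-1}]\,F(q)=0\qquad\text{and}\qquad [q^{2r}]\,F(q)=\sum_{\substack{d\mid r\\ r/d\ \text{odd}}} d,$$ where $d$ runs over the positive divisors of $r$. -/

import Mathlib

/-- The double Lambert series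
`∑_{m,n ≥ 1} (-q)^(2mn+m-1) / ((1 + q^(2n-1)) (1 - q^(2m-1)))`: the term of index `(m, n)`.
The natural-number subtractions are exact because `m` and `n` are positive. -/
noncomputable def lambertTerm (q : ℂ) (p : ℕ+ × ℕ+) : ℂ :=
  (-q) ^ (2 * (p.1 : ℕ) * (p.2 : ℕ) + (p.1 : ℕ) - 1) /
    ((1 + q ^ (2 * (p.2 : ℕ) - 1)) * (1 - q ^ (2 * (p.1 : ℕ) - 1)))

/-- The sum of the double Lambert series, as a function of the complex variable `q`
(of interest for `‖q‖ < 1`, where the series converges absolutely). -/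
noncomputable def lambertSum (q : ℂ) : ℂ :=
  ∑' p : ℕ+ × ℕ+, lambertTerm q p

namespace DoubleLambert

/-! Expanding both denominators geometrically turns the series into a signed sum of powers of `-q`,
so its `k`-th coefficient is `(-1) ^ k * signedCount k`. For odd `k` the terms cancel in pairs under
`reduceSwap`. For `k = 2r`, consider solutions of `xy + zw = 4r` in odd numbers, signed by the
classes of `y`, `w` mod 4. Their total vanishes (`sum_oddQuadruples`); the parts `y > w` and `y < w`
each give `-signedCount (2 * r)`, and the diagonal `y = w` gives twice the divisor sum
(`card_oddQuadruples_eq`). -/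

/-- The exponent of the monomial of index `((m, n), (a, b))` in the fourfold geometric expansion of
the double Lambert series. -/
def weight (t : (ℕ × ℕ) × (ℕ × ℕ)) : ℕ :=
  (2 * t.1.2 + 1) * (t.1.1 + t.2.1 + 1) + (2 * t.1.1 + 1) * (t.2.2 + 1)

/-- This bound makes each fiber finite and dominates the fourfold series by a product of geometric
series. -/
lemma add_lt_weight (t : (ℕ × ℕ) × (ℕ × ℕ)) :
    t.1.1 + t.1.2 + t.2.1 + t.2.2 < weight t := by
  obtain ⟨⟨m, n⟩, a, b⟩ := t
  simp only [weight]
  nlinarith [Nat.zero_le (n * m), Nat.zero_le (n * a), Nat.zero_le (m * b)]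

/-- The indices of weight `k`. -/
def fiber (k : ℕ) : Finset ((ℕ × ℕ) × (ℕ × ℕ)) :=
  ((Finset.range k ×ˢ Finset.range k) ×ˢ (Finset.range k ×ˢ Finset.range k)).filter
    fun t => weight t = k

lemma mem_fiber {k : ℕ} {t : (ℕ × ℕ) × (ℕ × ℕ)} : t ∈ fiber k ↔ weight t = k := by
  have := add_lt_weight t
  simp only [fiber, Finset.mem_filter, Finset.mem_product, Finset.mem_range, and_iff_right_iff_imp]
  omega

/-- The number of indices of weight `k`, counted with the sign `(-1) ^ b`. -/
def signedCount (k : ℕ) : ℤ := ∑ t ∈ fiber k, (-1) ^ t.2.2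

/-! ### Odd coefficients -/

/-- A weight-preserving involution that reverses the sign when the weight is odd. -/
def reduceSwap (t : (ℕ × ℕ) × (ℕ × ℕ)) : (ℕ × ℕ) × (ℕ × ℕ) :=
  ((t.1.2 % (t.2.2 + 1), t.1.1 + (t.1.2 / (t.2.2 + 1)) * (t.1.1 + t.2.1 + 1)),
    (t.2.2 - t.1.2 % (t.2.2 + 1), t.1.1 + t.2.1))

/-- Put `M = m + a + 1`, `B = b + 1` and `n = u + i * B` with `u < B`. The part `2 * i * B * M` of
`(2n+1)M` moves to the other product, leaving `(2u+1)M + (2(m + iM)+1)B`; then the roles of `M` and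
`B` are exchanged. -/
lemma weight_reduceSwap (t : (ℕ × ℕ) × (ℕ × ℕ)) : weight (reduceSwap t) = weight t := by
  obtain ⟨⟨m, n⟩, a, b⟩ := t
  have h1 : n % (b + 1) < b + 1 := Nat.mod_lt _ (by omega)
  have h2 := Nat.mod_add_div n (b + 1)
  have h3 : n % (b + 1) + (b - n % (b + 1)) = b := by omega
  simp only [weight, reduceSwap, h3]
  generalize n % (b + 1) = u at *
  generalize n / (b + 1) = i at *
  subst h2
  ring

lemma reduceSwap_reduceSwap (t : (ℕ × ℕ) × (ℕ × ℕ)) : reduceSwap (reduceSwap t) = t := by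
  obtain ⟨⟨m, n⟩, a, b⟩ := t
  have h1 : n % (b + 1) < b + 1 := Nat.mod_lt _ (by omega)
  have h2 := Nat.mod_add_div n (b + 1)
  have h3 : n % (b + 1) + (b - n % (b + 1)) = b := by omega
  have h4 : (m + n / (b + 1) * (m + a + 1)) % (m + a + 1) = m := by
    rw [Nat.add_mul_mod_self_right, Nat.mod_eq_of_lt (by omega)]
  have h5 : (m + n / (b + 1) * (m + a + 1)) / (m + a + 1) = n / (b + 1) := by
    rw [Nat.add_mul_div_right _ _ (by omega), Nat.div_eq_of_lt (by omega), zero_add]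
  simp only [reduceSwap, h3, h4, h5, Prod.mk.injEq, true_and, and_true]
  refine ⟨?_, by omega⟩
  rw [mul_comm]
  exact h2

lemma signedCount_odd {k : ℕ} (hk : Odd k) : signedCount k = 0 := by
  have sign : ∀ t ∈ fiber k, (-1 : ℤ) ^ t.2.2 + (-1) ^ (reduceSwap t).2.2 = 0 := by
    rintro ⟨⟨m, n⟩, a, b⟩ ht
    rw [mem_fiber] at ht
    simp only [weight] at ht
    simp only [reduceSwap]
    rw [← ht] at hk
    -- The weight has the parity of `(m + a + 1) + (b + 1)`, so `b` and the new last entry `m + a`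
    -- have opposite parity.
    rcases Nat.even_or_odd b with hb | hb <;> rcases Nat.even_or_odd (m + a) with hm | hm
    · have h1 : Odd ((2 * n + 1) * (m + a + 1)) := (odd_two_mul_add_one n).mul hm.add_one
      have h2 : Odd ((2 * m + 1) * (b + 1)) := (odd_two_mul_add_one m).mul hb.add_one
      exact absurd hk (Nat.not_odd_iff_even.2 (h1.add_odd h2))
    · simp [hb.neg_one_pow, hm.neg_one_pow]
    · simp [hb.neg_one_pow, hm.neg_one_pow]
    · have h1 : Even (m + a + 1) := hm.add_one
      have h2 : Even (b + 1) := hb.add_one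
      exact absurd hk (Nat.not_odd_iff_even.2 ((h1.mul_left _).add (h2.mul_left _)))
  refine Finset.sum_involution (fun t _ => reduceSwap t) sign ?_ ?_ ?_
  · intro t ht h0 h
    have := sign t ht
    rw [h] at this
    omega
  · intro t ht
    rw [mem_fiber] at ht ⊢
    rw [weight_reduceSwap, ht]
  · intro t _
    exact reduceSwap_reduceSwap t

/-! ### Even coefficients -/

/-- The indices `((m, p), (a, n))` with `(2m+1)(2p+1) + (2a+1)(2n+1) = 4r`. -/
def oddQuadruples (r : ℕ) : Finset ((ℕ × ℕ) × (ℕ × ℕ)) :=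
  ((Finset.range (4 * r) ×ˢ Finset.range (4 * r)) ×ˢ
    (Finset.range (4 * r) ×ˢ Finset.range (4 * r))).filter
    fun t => (2 * t.1.1 + 1) * (2 * t.1.2 + 1) + (2 * t.2.1 + 1) * (2 * t.2.2 + 1) = 4 * r

lemma mem_oddQuadruples {r : ℕ} {t : (ℕ × ℕ) × (ℕ × ℕ)} : t ∈ oddQuadruples r ↔
    (2 * t.1.1 + 1) * (2 * t.1.2 + 1) + (2 * t.2.1 + 1) * (2 * t.2.2 + 1) = 4 * r := by
  obtain ⟨⟨m, p⟩, a, n⟩ := t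
  simp only [oddQuadruples, Finset.mem_filter, Finset.mem_product, Finset.mem_range,
    and_iff_right_iff_imp]
  intro h
  refine ⟨⟨?_, ?_⟩, ?_, ?_⟩ <;>
    nlinarith [Nat.zero_le (m * p), Nat.zero_le (a * n)]

/-- Modulo 4, exactly one of the two odd products is 3, and its two factors are then in different
classes. -/
lemma odd_add_of_mem_oddQuadruples {r m p a n : ℕ} (h : ((m, p), (a, n)) ∈ oddQuadruples r) :
    Odd (m + p + (a + n)) := by
  rw [mem_oddQuadruples] at h
  have : 4 * (m * p) + 4 * (a * n) + 2 * (m + p + (a + n)) + 2 = 4 * r := by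
    rw [← h]; ring
  rw [Nat.odd_iff]
  omega

/-- Swap the two factors of the product that is congruent to `3` modulo `4`. -/
def swapFactors (t : (ℕ × ℕ) × (ℕ × ℕ)) : (ℕ × ℕ) × (ℕ × ℕ) :=
  if Odd (t.1.1 + t.1.2) then (t.1.swap, t.2) else (t.1, t.2.swap)

lemma sum_oddQuadruples (r : ℕ) :
    ∑ t ∈ oddQuadruples r, (-1 : ℤ) ^ (t.1.2 + t.2.2) = 0 := by
  have sign : ∀ t ∈ oddQuadruples r, (-1 : ℤ) ^ (t.1.2 + t.2.2) +
      (-1) ^ ((swapFactors t).1.2 + (swapFactors t).2.2) = 0 := by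
    rintro ⟨⟨m, p⟩, a, n⟩ ht
    have h := odd_add_of_mem_oddQuadruples ht
    have key : ∀ u v : ℕ, Odd (u + v) → (-1 : ℤ) ^ u + (-1) ^ v = 0 := by
      intro u v huv
      rcases Nat.even_or_odd u with hu | hu
      · have hv : Odd v := by rw [Nat.odd_add] at huv; grind
        simp [hu.neg_one_pow, hv.neg_one_pow]
      · have hv : Even v := by rw [Nat.odd_add] at huv; grind
        simp [hu.neg_one_pow, hv.neg_one_pow]
    apply key
    simp only [swapFactors]
    split_ifs with hmp <;> simp only [Prod.swap] <;> grind
  refine Finset.sum_involution (fun t _ => swapFactors t) sign ?_ ?_ ?_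
  · intro t ht h0 h
    have := sign t ht
    rw [h] at this
    omega
  · rintro ⟨⟨m, p⟩, a, n⟩ ht
    rw [mem_oddQuadruples] at ht ⊢
    simp only [swapFactors]
    split_ifs <;> simp only [Prod.swap] at ht ⊢ <;> linarith
  · rintro ⟨⟨m, p⟩, a, n⟩ _
    by_cases h : Odd (m + p)
    · have h' : Odd (p + m) := by rwa [add_comm]
      simp [swapFactors, h, h']
    · simp [swapFactors, h]

lemma sum_oddQuadruples_gt (r : ℕ) :
    ∑ t ∈ (oddQuadruples r).filter (fun t => t.2.2 < t.1.2), (-1 : ℤ) ^ (t.1.2 + t.2.2) =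
      -signedCount (2 * r) := by
  rw [signedCount, ← Finset.sum_neg_distrib]
  -- With `p = n + b + 1` the left side of the equation is exactly twice the weight of `((m, n), (a,
  -- b))`.
  refine Finset.sum_nbij' (fun t => ((t.1.1, t.2.2), (t.2.1, t.1.2 - t.2.2 - 1)))
    (fun t => ((t.1.1, t.1.2 + t.2.2 + 1), (t.2.1, t.1.2))) ?_ ?_ ?_ ?_ ?_
  · rintro ⟨⟨m, p⟩, a, n⟩ ht
    rw [Finset.mem_filter, mem_oddQuadruples] at ht
    obtain ⟨ht, hlt⟩ := ht
    obtain ⟨b, rfl⟩ : ∃ b, p = n + b + 1 := Nat.exists_eq_add_of_lt hlt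
    have h3 : n + b + 1 - n - 1 = b := by omega
    simp only [mem_fiber, weight, h3] at ht ⊢
    linarith
  · rintro ⟨⟨m, n⟩, a, b⟩ ht
    rw [Finset.mem_filter, mem_oddQuadruples]
    rw [mem_fiber] at ht
    simp only [weight] at ht ⊢
    exact ⟨by linarith, by omega⟩
  · rintro ⟨⟨m, p⟩, a, n⟩ ht
    rw [Finset.mem_filter] at ht
    have := ht.2
    simp only [Prod.mk.injEq, true_and, and_true] at this ⊢
    omega
  · rintro ⟨⟨m, n⟩, a, b⟩ _
    simp only [Prod.mk.injEq, true_and]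
    omega
  · rintro ⟨⟨m, p⟩, a, n⟩ ht
    rw [Finset.mem_filter] at ht
    obtain ⟨b, rfl⟩ : ∃ b, p = n + b + 1 := Nat.exists_eq_add_of_lt ht.2
    have h3 : n + b + 1 - n - 1 = b := by omega
    simp only [h3]
    rw [show n + b + 1 + n = 2 * n + (b + 1) by ring, pow_add, pow_mul]
    simp [pow_succ]

lemma sum_oddQuadruples_lt (r : ℕ) :
    ∑ t ∈ (oddQuadruples r).filter (fun t => t.1.2 < t.2.2), (-1 : ℤ) ^ (t.1.2 + t.2.2) =
      -signedCount (2 * r) := by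
  rw [← sum_oddQuadruples_gt]
  refine Finset.sum_nbij' Prod.swap Prod.swap ?_ ?_ (fun _ _ => Prod.swap_swap _)
    (fun _ _ => Prod.swap_swap _) ?_
  · intro t ht
    rw [Finset.mem_filter, mem_oddQuadruples] at ht ⊢
    exact ⟨by simpa [add_comm] using ht.1, ht.2⟩
  · intro t ht
    rw [Finset.mem_filter, mem_oddQuadruples] at ht ⊢
    exact ⟨by simpa [add_comm] using ht.1, ht.2⟩
  · intro t _
    simp [add_comm]

lemma card_oddQuadruples_eq {r : ℕ} (hr : 1 ≤ r) :
    ((oddQuadruples r).filter (fun t => t.1.2 = t.2.2)).card =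
      ∑ d ∈ r.divisors.filter (fun d => Odd (r / d)), 2 * d := by
  have : ∑ d ∈ r.divisors.filter (fun d => Odd (r / d)), 2 * d =
      ((r.divisors.filter (fun d => Odd (r / d))).sigma fun d => Finset.range (2 * d)).card := by
    simp [Finset.card_sigma]
  rw [this]
  symm
  -- On the diagonal the equation reads `(2p+1)(m+a+1) = 2r`. Hence `2p+1` divides `r`, and with `d
  -- = r / (2p+1)` there are `2d` choices of `m`.
  refine Finset.card_nbij' (fun s => ((s.2, r / s.1 / 2), (2 * s.1 - 1 - s.2, r / s.1 / 2)))
    (fun t => ⟨r / (2 * t.1.2 + 1), t.1.1⟩) ?_ ?_ ?_ ?_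
  · rintro ⟨d, j⟩ h
    simp only [Finset.coe_sigma, Finset.coe_filter, Nat.mem_divisors, Set.mem_sigma_iff,
      Set.mem_ofPred_eq, Finset.coe_range, Set.mem_Iio] at h
    obtain ⟨⟨⟨⟨e, rfl⟩, _⟩, hodd⟩, hj⟩ := h
    have hd : 0 < d := by omega
    rw [Nat.mul_div_cancel_left _ hd] at hodd
    obtain ⟨n, rfl⟩ := hodd
    have hn : (2 * n + 1) / 2 = n := by omega
    simp only [Finset.coe_filter, Set.mem_ofPred_eq, mem_oddQuadruples,
      Nat.mul_div_cancel_left _ hd, hn, and_true]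
    obtain ⟨i, hi⟩ : ∃ i, 2 * d - 1 - j = i := ⟨_, rfl⟩
    have hd' : 2 * d = i + j + 1 := by omega
    rw [hi]
    have h : (2 * n + 1) * (2 * d) = (2 * n + 1) * (i + j + 1) := by rw [hd']
    linarith
  · rintro ⟨⟨m, p⟩, a, n⟩ h
    simp only [Finset.coe_filter, Set.mem_ofPred_eq, mem_oddQuadruples] at h
    obtain ⟨h, rfl⟩ := h
    have h2 : (2 * p + 1) * (m + a + 1) = 2 * r := by linarith
    have hdvd : (2 * p + 1) ∣ r :=
      Nat.Coprime.dvd_of_dvd_mul_left (by simp) (Dvd.intro _ h2)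
    obtain ⟨d, rfl⟩ := hdvd
    have hd : 0 < d := Nat.pos_of_ne_zero (by rintro rfl; simp at hr)
    have h3 : m + a + 1 = 2 * d := by
      apply Nat.eq_of_mul_eq_mul_left (show 0 < 2 * p + 1 by omega)
      linarith
    simp only [Finset.coe_sigma, Finset.coe_filter, Nat.mem_divisors, Set.mem_sigma_iff,
      Set.mem_ofPred_eq, Finset.coe_range, Set.mem_Iio,
      Nat.mul_div_cancel_left _ (show 0 < 2 * p + 1 by omega), Nat.mul_div_cancel _ hd]
    refine ⟨⟨⟨Dvd.intro_left _ rfl, by omega⟩, by simp⟩, by omega⟩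
  · rintro ⟨d, j⟩ h
    simp only [Finset.coe_sigma, Finset.coe_filter, Nat.mem_divisors, Set.mem_sigma_iff,
      Set.mem_ofPred_eq, Finset.coe_range, Set.mem_Iio] at h
    obtain ⟨⟨⟨⟨e, rfl⟩, _⟩, hodd⟩, hj⟩ := h
    have hd : 0 < d := by omega
    rw [Nat.mul_div_cancel_left _ hd] at hodd
    obtain ⟨n, rfl⟩ := hodd
    have hn : (2 * n + 1) / 2 = n := by omega
    simp [Nat.mul_div_cancel_left _ hd, hn]
  · rintro ⟨⟨m, p⟩, a, n⟩ h
    simp only [Finset.coe_filter, Set.mem_ofPred_eq, mem_oddQuadruples] at h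
    obtain ⟨h, rfl⟩ := h
    have h2 : (2 * p + 1) * (m + a + 1) = 2 * r := by linarith
    have hdvd : (2 * p + 1) ∣ r :=
      Nat.Coprime.dvd_of_dvd_mul_left (by simp) (Dvd.intro _ h2)
    obtain ⟨d, rfl⟩ := hdvd
    have hd : 0 < d := Nat.pos_of_ne_zero (by rintro rfl; simp at hr)
    have h3 : m + a + 1 = 2 * d := by
      apply Nat.eq_of_mul_eq_mul_left (show 0 < 2 * p + 1 by omega)
      linarith
    simp only [Nat.mul_div_cancel_left _ (show 0 < 2 * p + 1 by omega), Nat.mul_div_cancel _ hd,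
      Prod.mk.injEq, true_and]
    omega

lemma signedCount_two_mul {r : ℕ} (hr : 1 ≤ r) :
    signedCount (2 * r) = ∑ d ∈ r.divisors.filter (fun d => Odd (r / d)), (d : ℤ) := by
  have heq : ∑ t ∈ (oddQuadruples r).filter (fun t => t.1.2 = t.2.2),
      (-1 : ℤ) ^ (t.1.2 + t.2.2) =
      2 * ∑ d ∈ r.divisors.filter (fun d => Odd (r / d)), (d : ℤ) := by
    rw [Finset.sum_congr rfl (g := fun _ => (1 : ℤ)), Finset.sum_const, card_oddQuadruples_eq hr]
    · simp [Finset.mul_sum]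
    · intro t ht
      rw [(Finset.mem_filter.1 ht).2, ← two_mul, pow_mul]
      simp
  have hsplit := sum_oddQuadruples r
  rw [← Finset.sum_filter_add_sum_filter_not _ (fun t => t.2.2 < t.1.2),
    ← Finset.sum_filter_add_sum_filter_not ((oddQuadruples r).filter fun t => ¬ t.2.2 < t.1.2)
      (fun t => t.1.2 < t.2.2), Finset.filter_filter, Finset.filter_filter] at hsplit
  have e1 : (oddQuadruples r).filter (fun t => ¬ t.2.2 < t.1.2 ∧ t.1.2 < t.2.2) =
      (oddQuadruples r).filter (fun t => t.1.2 < t.2.2) :=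
    Finset.filter_congr fun t _ => by omega
  have e2 : (oddQuadruples r).filter (fun t => ¬ t.2.2 < t.1.2 ∧ ¬ t.1.2 < t.2.2) =
      (oddQuadruples r).filter (fun t => t.1.2 = t.2.2) :=
    Finset.filter_congr fun t _ => by omega
  rw [sum_oddQuadruples_gt, e1, e2, sum_oddQuadruples_lt, heq] at hsplit
  linarith

/-! ### Geometric expansion and power series -/

/-- The monomials of the fourfold geometric expansion of the double Lambert series. -/
noncomputable def monomial (q : ℂ) (t : (ℕ × ℕ) × (ℕ × ℕ)) : ℂ :=
  (-1) ^ t.2.2 * (-q) ^ weight t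

lemma summable_norm_monomial {q : ℂ} (hq : ‖q‖ < 1) : Summable fun t => ‖monomial q t‖ := by
  have hg : Summable fun n : ℕ => ‖q‖ ^ n := summable_geometric_of_lt_one (norm_nonneg q) hq
  have hp : Summable fun s : ℕ × ℕ => ‖q‖ ^ s.1 * ‖q‖ ^ s.2 :=
    hg.mul_of_nonneg hg (fun _ => by positivity) fun _ => by positivity
  have hpp : Summable fun t : (ℕ × ℕ) × (ℕ × ℕ) =>
      (‖q‖ ^ t.1.1 * ‖q‖ ^ t.1.2) * (‖q‖ ^ t.2.1 * ‖q‖ ^ t.2.2) :=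
    hp.mul_of_nonneg hp (fun _ => by positivity) fun _ => by positivity
  refine hpp.of_nonneg_of_le (fun _ => norm_nonneg _) fun t => ?_
  have hw := add_lt_weight t
  calc ‖monomial q t‖ = ‖q‖ ^ weight t := by simp [monomial]
    _ ≤ ‖q‖ ^ (t.1.1 + t.1.2 + (t.2.1 + t.2.2)) :=
      pow_le_pow_of_le_one (norm_nonneg q) hq.le (by omega)
    _ = _ := by simp only [pow_add]

lemma hasSum_lambertTerm {q : ℂ} (hq : ‖q‖ < 1) (p : ℕ × ℕ) :
    HasSum (fun s => monomial q (p, s)) (lambertTerm q (p.1.succPNat, p.2.succPNat)) := by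
  obtain ⟨m, n⟩ := p
  have hlt : ∀ k : ℕ, ‖q‖ ^ (2 * k + 1) < 1 := fun k =>
    pow_lt_one₀ (norm_nonneg q) hq (by omega)
  have h1 : HasSum (fun a : ℕ => ((-q) ^ (2 * n + 1)) ^ a) (1 - (-q) ^ (2 * n + 1))⁻¹ :=
    hasSum_geometric_of_norm_lt_one (by simpa using hlt n)
  have h2 : HasSum (fun b : ℕ => (q ^ (2 * m + 1)) ^ b) (1 - q ^ (2 * m + 1))⁻¹ :=
    hasSum_geometric_of_norm_lt_one (by simpa using hlt m)
  have hprod : ∀ s : ℕ × ℕ, (-q) ^ (2 * (m + 1) * (n + 1) + m) *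
      (((-q) ^ (2 * n + 1)) ^ s.1 * (q ^ (2 * m + 1)) ^ s.2) = monomial q ((m, n), s) := by
    rintro ⟨a, b⟩
    have hodd : q ^ (2 * m + 1) = -(-q) ^ (2 * m + 1) := by
      rw [(odd_two_mul_add_one m).neg_pow, neg_neg]
    have hw : weight ((m, n), (a, b)) =
        2 * (m + 1) * (n + 1) + m + (2 * n + 1) * a + (2 * m + 1) * b := by
      simp only [weight]; ring
    rw [monomial, hw, hodd, neg_pow ((-q) ^ (2 * m + 1)) b, pow_add _ _ ((2 * m + 1) * b),
      pow_add _ _ ((2 * n + 1) * a), pow_mul _ (2 * n + 1), pow_mul _ (2 * m + 1)]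
    ring
  have hs : Summable fun s : ℕ × ℕ => ((-q) ^ (2 * n + 1)) ^ s.1 * (q ^ (2 * m + 1)) ^ s.2 :=
    summable_mul_of_summable_norm
      (by simpa [norm_pow] using summable_geometric_of_lt_one (by positivity) (hlt n))
      (by simpa [norm_pow] using summable_geometric_of_lt_one (by positivity) (hlt m))
  have h : HasSum (fun s => monomial q ((m, n), s)) _ :=
    funext hprod ▸ (h1.mul h2 hs).mul_left ((-q) ^ (2 * (m + 1) * (n + 1) + m))
  convert h using 1
  have e1 : 2 * (n + 1) - 1 = 2 * n + 1 := by omega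
  have e2 : 2 * (m + 1) - 1 = 2 * m + 1 := by omega
  have e3 : 2 * (m + 1) * (n + 1) + (m + 1) - 1 = 2 * (m + 1) * (n + 1) + m := by omega
  simp only [lambertTerm, Nat.succPNat_coe, Nat.succ_eq_add_one, e1, e2, e3]
  rw [(odd_two_mul_add_one n).neg_pow q, sub_neg_eq_add, div_eq_mul_inv, mul_inv]

lemma summable_norm_lambertTerm {q : ℂ} (hq : ‖q‖ < 1) :
    Summable fun p : ℕ+ × ℕ+ => ‖lambertTerm q p‖ := by
  rw [← (Equiv.pnatEquivNat.symm.prodCongr Equiv.pnatEquivNat.symm).summable_iff]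
  have hs := summable_norm_monomial hq
  refine hs.prod.of_nonneg_of_le (fun _ => norm_nonneg _) fun p => ?_
  have hp : Summable fun s => ‖monomial q (p, s)‖ := hs.prod_factor p
  have := norm_tsum_le_tsum_norm hp
  rw [(hasSum_lambertTerm hq p).tsum_eq] at this
  exact this

lemma tsum_monomial {q : ℂ} (hq : ‖q‖ < 1) : ∑' t, monomial q t = lambertSum q := by
  rw [lambertSum, ← (Equiv.pnatEquivNat.symm.prodCongr Equiv.pnatEquivNat.symm).tsum_eq,
    (summable_norm_monomial hq).of_norm.tsum_prod]
  exact tsum_congr fun p => (hasSum_lambertTerm hq p).tsum_eq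

lemma hasSum_lambertSum {q : ℂ} (hq : ‖q‖ < 1) :
    HasSum (fun k => ((-1) ^ k * (signedCount k : ℂ)) * q ^ k) (lambertSum q) := by
  have h := (summable_norm_monomial hq).of_norm.hasSum
  rw [tsum_monomial hq, ← (Equiv.sigmaFiberEquiv weight).hasSum_iff] at h
  -- Absolute convergence allows regrouping by weight, with finite inner sums.
  refine h.sigma fun k => ?_
  have hmem : ∀ t, t ∈ fiber k ↔ weight t = k := fun _ => mem_fiber
  have : Fintype {t // weight t = k} := Fintype.subtype (fiber k) hmem
  have hfin := hasSum_fintype fun t : {t // weight t = k} => monomial q t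
  rw [← Finset.sum_subtype (fiber k) hmem (monomial q)] at hfin
  suffices hsum : (-1) ^ k * (signedCount k : ℂ) * q ^ k = ∑ t ∈ fiber k, monomial q t by
    rw [hsum]
    exact hfin
  rw [signedCount, Int.cast_sum, Finset.mul_sum, Finset.sum_mul]
  refine Finset.sum_congr rfl fun t ht => ?_
  rw [monomial, (hmem t).1 ht, neg_pow q]
  push_cast
  ring

lemma hasFPowerSeriesOnBall_lambertSum :
    HasFPowerSeriesOnBall lambertSum
      (FormalMultilinearSeries.ofScalars ℂ fun k => (-1 : ℂ) ^ k * (signedCount k : ℂ)) 0 1 where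
  r_le := by
    refine ENNReal.le_of_forall_nnreal_lt fun r hr => ?_
    have hr1 : ‖((r : ℝ) : ℂ)‖ < 1 := by simpa using hr
    -- Terms of the series convergent at the real point `r < 1` tend to zero, which bounds the
    -- radius below.
    refine FormalMultilinearSeries.le_radius_of_tendsto _ (l := 0) ?_
    have h := (hasSum_lambertSum hr1).summable.tendsto_atTop_zero.norm
    rw [norm_zero] at h
    refine h.congr fun k => ?_
    rw [FormalMultilinearSeries.ofScalars_norm, norm_mul, norm_pow ((r : ℝ) : ℂ)]
    simp
  r_pos := one_pos
  hasSum := by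
    intro y hy
    have hy1 : ‖y‖ < 1 := by
      rw [← ENNReal.ofReal_one, Metric.eball_ofReal] at hy
      simpa using hy
    simpa [FormalMultilinearSeries.ofScalars_apply_eq, mul_comm] using hasSum_lambertSum hy1

end DoubleLambert

open DoubleLambert in
theorem corollary5p9 :
    (∀ q : ℂ, ‖q‖ < 1 → Summable (fun p : ℕ+ × ℕ+ => ‖lambertTerm q p‖)) ∧
    ∃ c : FormalMultilinearSeries ℂ ℂ ℂ,
      HasFPowerSeriesOnBall lambertSum c 0 1 ∧
      (∀ r : ℕ, 1 ≤ r → c.coeff (2 * r - 1) = 0) ∧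
      (∀ r : ℕ, 1 ≤ r →
        c.coeff (2 * r) = ∑ d ∈ r.divisors.filter (fun d => Odd (r / d)), (d : ℂ)) := by
  refine ⟨fun q hq => summable_norm_lambertTerm hq, _, hasFPowerSeriesOnBall_lambertSum,
    fun r hr => ?_, fun r hr => ?_⟩
  · have hodd : Odd (2 * r - 1) := ⟨r - 1, by omega⟩
    rw [FormalMultilinearSeries.coeff_ofScalars, signedCount_odd hodd]
    simp
  · rw [FormalMultilinearSeries.coeff_ofScalars, signedCount_two_mul hr]
    simp [pow_mul]
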